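/- \textbf{Theorem (Leray type homology spectral sequence).} For a simplicial set $X$ let $\Delta/X$ be its category of simplices: its objects are the simplices of $X$, and its morphisms $x\to x'$ are the morphisms $\theta$ of $\Delta$ with $x=X(\theta)(x')$. A map $f\colon X\to Y$ induces a functor $\Delta/f\colon\Delta/X\to\Delta/Y$, $x\mapsto f(x)$. Let $\mathscr A$ be a cocomplete abelian category with exact coproducts. For a functor $T\colon(\Delta/X)^{op}\to\mathscr A$ (a contravariant Gabriel--Zisman natural system on $X$), the Gabriel--Zisman homology $H^{GZ}_n(X,T)$ is the $n$-th homology of the chain complex $C_n=\bigoplus_{\sigma\in X_n}T(\sigma)$ whose differential $C_{n+1}\to C_n$ is $\sum_{i=0}^{n+1}(-1)^i(\delta^i)^{\#}$, where $(\delta^i)^{\#}\colon T(\sigma)\to T(\sigma\circ\delta^i)$ is induced by the $i$-th coface map. It is functorial in pairs $(\varphi,\tau)\colon(X,T)\to(X',T')$ with $\varphi\colon X\to X'$ a simplicial map and $\tau\colon T\to T'\circ(\Delta/\varphi)^{op}$ a natural transformation. Let $f\colon X\to Y$ be a map of simplicial sets and let $Lan^{(\Delta/f)^{op}}\colon \mathrm{Fun}((\Delta/X)^{op},\mathscr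 A)\to\mathrm{Fun}((\Delta/Y)^{op},\mathscr A)$ be the left Kan extension functor along $(\Delta/f)^{op}$. Then its left satellites $L_q((\Delta/f)^{op})_*$, $q\ge 0$, exist; that is, there is a universal homological $\partial$-functor whose degree-$0$ part is $Lan^{(\Delta/f)^{op}}$. For every $T\colon(\Delta/X)^{op}\to\mathscr A$ there is a first quadrant homology spectral sequence $(E^r_{p,q})_{r\ge 2}$, with differentials $d^r\colon E^r_{p,q}\to E^r_{p-r,q+r-1}$, $$E^2_{p,q}\cong H^{GZ}_p\bigl(Y,\,(L_q((\Delta/f)^{op})_*)(T)\bigr)\Longrightarrow H^{GZ}_{p+q}(X,T).$$ Here convergence means that $H^{GZ}_n(X,T)$ has a filtration $0=F_{-1}\subseteq F_0\subseteq\dots\subseteq F_n=H^{GZ}_n(X,T)$ with $F_p/F_{p-1}\cong E^\infty_{p,n-p}$. The spectral sequence is natural in $f$ and $T$: it is a functor on the category whose objects are the pairs $(f\colon X\to Y,\,T)$ and whose morphisms $(f,T)\to(f',T')$ are triples of maps $g\colon X\to X'$, $h\colon Y\to Y'$ with $f'g=hf$ and a natural transformation $\tau\colon T\to T'\circ(\Delta/g)^{op}$.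 The canonical transformation $Lan^{(\Delta/f)^{op}}(S\circ(\Delta/g)^{op})\to Lan^{(\Delta/f')^{op}}(S)\circ(\Delta/h)^{op}$, natural in $S\colon(\Delta/X')^{op}\to\mathscr A$, extends uniquely to a morphism of $\partial$-functors between the satellites, and the isomorphism of the $E^2$-terms is natural with respect to the maps on $H^{GZ}_p$ induced by $h$, $\tau$ and this morphism. The filtrations and the isomorphisms $F_p/F_{p-1}\cong E^\infty_{p,n-p}$ are natural with respect to the maps $H^{GZ}_n(X,T)\to H^{GZ}_n(X',T')$ induced by $(g,\tau)$. -/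

import Mathlib

open CategoryTheory CategoryTheory.Limits

universe w v u

/-! ### Contravariant Gabriel-Zisman natural systems -/

namespace GabrielZisman

/-- The opposite `(Δ/X)ᵒᵖ` of the category of simplices of a simplicial set `X`.  Its objects are
the simplices `x` of `X`; a morphism `x ⟶ x'` is a morphism `θ` of `Δᵒᵖ` with `X(θ)(x) = x'`. -/
abbrev OpSimplices (X : SSet.{u}) : Type u := X.Elements

/-- The functor `(Δ/f)ᵒᵖ : (Δ/X)ᵒᵖ ⥤ (Δ/Y)ᵒᵖ`, `x ↦ f x`, induced by a map `f : X ⟶ Y`. -/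
abbrev opSimplicesMap {X Y : SSet.{u}} (f : X ⟶ Y) : OpSimplices X ⥤ OpSimplices Y :=
  CategoryOfElements.map f

/-- A contravariant Gabriel-Zisman natural system: a simplicial set `X` together with a functor
`T : (Δ/X)ᵒᵖ ⥤ A`. -/
structure NatSystem (A : Type w) [Category.{v} A] where
  /-- the simplicial set -/
  X : SSet.{u}
  /-- the coefficient system -/
  T : OpSimplices X ⥤ A

namespace NatSystem

variable {A : Type w} [Category.{v} A]

/-- A morphism `(φ, τ) : (X, T_X) ⟶ (Y, T_Y)` is a simplicial map `φ : X ⟶ Y` with a natural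
transformation `τ : T_X ⟶ T_Y ∘ (Δ/φ)ᵒᵖ`. -/
@[ext]
structure Hom (S S' : NatSystem.{w, v, u} A) where
  /-- the map of simplicial sets -/
  φ : S.X ⟶ S'.X
  /-- the natural transformation of coefficient systems -/
  τ : S.T ⟶ opSimplicesMap φ ⋙ S'.T

instance : Category (NatSystem.{w, v, u} A) where
  Hom := Hom
  id S := ⟨𝟙 S.X, 𝟙 S.T⟩
  comp a b := ⟨a.φ ≫ b.φ, a.τ ≫ Functor.whiskerLeft (opSimplicesMap a.φ) b.τ⟩
  id_comp a := by
    refine Hom.ext (Category.id_comp _) (heq_of_eq ?_)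
    ext x
    exact Category.id_comp _
  comp_id a := by
    refine Hom.ext (Category.comp_id _) (heq_of_eq ?_)
    ext x
    exact Category.comp_id _
  assoc a b c := by
    refine Hom.ext (Category.assoc _ _ _) (heq_of_eq ?_)
    ext x
    exact Category.assoc _ _ _

variable (A) in
/-- The functor that sends a natural system `(X, T)` to the simplicial set `X`. -/
def toSSet : NatSystem.{w, v, u} A ⥤ SSet.{u} where
  obj S := S.X
  map a := a.φ

end NatSystem

/-! ### The Gabriel-Zisman chain complex and its homology -/

section Homology

variable {A : Type w} [Category.{v} A] [HasCoproducts.{u} A]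

/-- The map `T(σ) ⟶ ⨁_{ρ ∈ X_m} T(ρ)` that an operator `θ` with `X(θ)(σ) = ρ` induces. -/
noncomputable def summandMap (S : NatSystem.{w, v, u} A) {n m : SimplexCategoryᵒᵖ} (θ : n ⟶ m)
    (σ : S.X.obj n) (ρ : S.X.obj m) (h : S.X.map θ σ = ρ) :
    S.T.obj (S.X.elementsMk n σ) ⟶ ∐ fun ρ : S.X.obj m => S.T.obj (S.X.elementsMk m ρ) :=
  S.T.map (CategoryOfElements.homMk (S.X.elementsMk n σ) (S.X.elementsMk m ρ) θ h) ≫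
    Sigma.ι (fun ρ : S.X.obj m => S.T.obj (S.X.elementsMk m ρ)) ρ

theorem summandMap_congr (S : NatSystem.{w, v, u} A) {n m : SimplexCategoryᵒᵖ} (θ : n ⟶ m)
    (σ : S.X.obj n) (ρ ρ' : S.X.obj m) (h : S.X.map θ σ = ρ) (h' : S.X.map θ σ = ρ') :
    summandMap S θ σ ρ h = summandMap S θ σ ρ' h' := by
  subst h; subst h'; rfl

/-- The simplicial object `[n] ↦ ⨁_{σ ∈ X_n} T(σ)`; an operator `θ` maps the summand `T(σ)` to the
summand `T(X(θ)(σ))` by the map that `T` induces. -/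
noncomputable def simplicialReplacement (S : NatSystem.{w, v, u} A) : SimplicialObject A where
  obj n := ∐ fun σ : S.X.obj n => S.T.obj (S.X.elementsMk n σ)
  map {n m} θ := Sigma.desc fun σ => summandMap S θ σ (S.X.map θ σ) rfl
  map_id n := by
    refine Sigma.hom_ext _ _ fun σ => ?_
    rw [Sigma.ι_desc, summandMap_congr S (𝟙 n) σ _ σ rfl (by simp)]
    refine (congrArg (· ≫ _) (S.T.map_id _)).trans ?_
    simp
  map_comp {n m k} θ η := by
    refine Sigma.hom_ext _ _ fun σ => ?_
    rw [Sigma.ι_desc, Sigma.ι_desc_assoc,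
      summandMap_congr S (θ ≫ η) σ _ (S.X.map η (S.X.map θ σ)) rfl (by simp)]
    simp only [summandMap, Category.assoc, Sigma.ι_desc]
    rw [← Category.assoc, ← S.T.map_comp]
    rfl

/-- The component `τ_σ : T_X(σ) ⟶ T_Y(φ σ)` of a morphism of natural systems. -/
def NatSystem.Hom.at {S S' : NatSystem.{w, v, u} A} (a : S ⟶ S') {n : SimplexCategoryᵒᵖ}
    (σ : S.X.obj n) :
    S.T.obj (S.X.elementsMk n σ) ⟶ S'.T.obj (S'.X.elementsMk n (a.φ.app n σ)) :=
  a.τ.app (S.X.elementsMk n σ)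

/-- The functoriality of the simplicial replacement: `(φ, τ)` maps the summand `T_X(σ)` to the
summand `T_Y(φ σ)` by `τ_σ`. -/
noncomputable def simplicialReplacementMap {S S' : NatSystem.{w, v, u} A} (a : S ⟶ S') :
    simplicialReplacement S ⟶ simplicialReplacement S' where
  app n := Sigma.desc fun σ : S.X.obj n => NatSystem.Hom.at a σ ≫
    Sigma.ι (fun ρ : S'.X.obj n => S'.T.obj (S'.X.elementsMk n ρ)) (a.φ.app n σ)
  naturality n m θ := by
    refine Sigma.hom_ext _ _ fun σ => ?_
    have e : S'.X.map θ (a.φ.app n σ) = a.φ.app m (S.X.map θ σ) :=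
      (NatTrans.naturality_apply a.φ θ σ).symm
    have key : S.T.map (CategoryOfElements.homMk (S.X.elementsMk n σ)
        (S.X.elementsMk m (S.X.map θ σ)) θ rfl) ≫ NatSystem.Hom.at a (S.X.map θ σ) =
        NatSystem.Hom.at a σ ≫ S'.T.map (CategoryOfElements.homMk
          (S'.X.elementsMk n (a.φ.app n σ)) (S'.X.elementsMk m (a.φ.app m (S.X.map θ σ))) θ e) :=
      a.τ.naturality (CategoryOfElements.homMk (S.X.elementsMk n σ)
        (S.X.elementsMk m (S.X.map θ σ)) θ rfl)
    dsimp only [simplicialReplacement]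
    rw [Sigma.ι_desc_assoc, Sigma.ι_desc_assoc, Category.assoc, Sigma.ι_desc,
      summandMap_congr S' θ _ _ _ rfl e]
    simp only [summandMap, Category.assoc, Sigma.ι_desc]
    rw [← Category.assoc, key, Category.assoc]

/-- The simplicial replacement as a functor on the category of natural systems. -/
noncomputable def simplicialReplacementFunctor :
    NatSystem.{w, v, u} A ⥤ SimplicialObject A where
  obj := simplicialReplacement
  map a := simplicialReplacementMap a
  map_id S := by
    ext n
    refine Sigma.hom_ext _ _ fun σ => ?_
    dsimp only [simplicialReplacementMap]
    rw [Sigma.ι_desc]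
    exact (Category.id_comp _).trans (Category.comp_id _).symm
  map_comp {S S' S''} a b := by
    ext n
    refine Sigma.hom_ext _ _ fun σ => ?_
    refine Eq.trans (Sigma.ι_desc _ _) ?_
    have h₁ := Sigma.ι_desc_assoc (fun σ : S.X.obj n => NatSystem.Hom.at a σ ≫
      Sigma.ι (fun ρ : S'.X.obj n => S'.T.obj (S'.X.elementsMk n ρ)) (a.φ.app n σ)) σ
      ((simplicialReplacementMap b).app n)
    refine Eq.trans ?_ h₁.symm
    have h₂ := Sigma.ι_desc (fun σ : S'.X.obj n => NatSystem.Hom.at b σ ≫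
      Sigma.ι (fun ρ : S''.X.obj n => S''.T.obj (S''.X.elementsMk n ρ)) (b.φ.app n σ))
      (a.φ.app n σ)
    refine Eq.trans ?_ (Category.assoc _ _ _).symm
    exact (Category.assoc _ _ _).trans (congrArg (NatSystem.Hom.at a σ ≫ ·) h₂.symm)

/-- The Gabriel-Zisman chain complex `C_*^{GZ}(X, T)`, with `C_n = ⨁_{σ ∈ X_n} T(σ)` and
differential the alternating sum of the maps induced by the cofaces `δⁱ`, as a functor on the
category of contravariant natural systems. -/
noncomputable def chainComplex [Preadditive A] : NatSystem.{w, v, u} A ⥤ ChainComplex A ℕ :=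
  simplicialReplacementFunctor ⋙ AlgebraicTopology.alternatingFaceMapComplex A

/-- Gabriel-Zisman homology `H_n^{GZ}(X, T)`. -/
noncomputable def homology [Abelian A] (n : ℕ) : NatSystem.{w, v, u} A ⥤ A :=
  chainComplex ⋙ HomologicalComplex.homologyFunctor A _ n

end Homology

end GabrielZisman

/-! ### Homological ∂-functors and left satellites -/

section Satellites

/-- A homological `∂`-functor between abelian categories: additive functors `L n`, `n ≥ 0`, and, for
every short exact sequence `0 ⟶ X₁ ⟶ X₂ ⟶ X₃ ⟶ 0`, connecting morphisms `L (n+1) X₃ ⟶ L n X₁` that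
are natural in the short exact sequence and make the long sequence a complex. -/
structure HomologicalDeltaFunctor (B : Type*) [Category B] [Abelian B]
    (C : Type*) [Category C] [Abelian C] where
  /-- the functors -/
  L : ℕ → B ⥤ C
  additive : ∀ n, (L n).Additive
  /-- the connecting morphisms -/
  δ : ∀ (n : ℕ) (S : ShortComplex B), S.ShortExact → ((L (n + 1)).obj S.X₃ ⟶ (L n).obj S.X₁)
  δ_naturality : ∀ (n : ℕ) {S S' : ShortComplex B} (φ : S ⟶ S') (hS : S.ShortExact)
    (hS' : S'.ShortExact),
    (L (n + 1)).map φ.τ₃ ≫ δ n S' hS' = δ n S hS ≫ (L n).map φ.τ₁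
  map_comp_δ : ∀ (n : ℕ) (S : ShortComplex B) (hS : S.ShortExact),
    (L (n + 1)).map S.g ≫ δ n S hS = 0
  δ_comp_map : ∀ (n : ℕ) (S : ShortComplex B) (hS : S.ShortExact),
    δ n S hS ≫ (L n).map S.f = 0

namespace HomologicalDeltaFunctor

variable {B : Type*} [Category B] [Abelian B] {C : Type*} [Category C] [Abelian C]

/-- A morphism of `∂`-functors: natural transformations in every degree that commute with the
connecting morphisms. -/
@[ext]
structure Hom (D D' : HomologicalDeltaFunctor B C) where
  /-- the natural transformation in degree `n` -/
  app : ∀ n, D.L n ⟶ D'.L n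
  comm : ∀ (n : ℕ) (S : ShortComplex B) (hS : S.ShortExact),
    (app (n + 1)).app S.X₃ ≫ D'.δ n S hS = D.δ n S hS ≫ (app n).app S.X₁

/-- A homological `∂`-functor `D` is universal if every natural transformation `D'₀ ⟶ D₀` from the
degree-zero part of a `∂`-functor `D'` extends uniquely to a morphism of `∂`-functors `D' ⟶ D`. -/
def IsUniversal (D : HomologicalDeltaFunctor B C) : Prop :=
  ∀ (D' : HomologicalDeltaFunctor B C) (α : D'.L 0 ⟶ D.L 0),
    ∃! φ : Hom D' D, φ.app 0 = α

/-- Precomposition of a `∂`-functor with an exact functor. -/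
def precomp (D : HomologicalDeltaFunctor B C) {B' : Type*} [Category B'] [Abelian B']
    (G : B' ⥤ B) [G.Additive] [PreservesFiniteLimits G] [PreservesFiniteColimits G] :
    HomologicalDeltaFunctor B' C where
  L n := G ⋙ D.L n
  additive n := by
    have := D.additive n
    infer_instance
  δ n S hS := D.δ n (S.map G) (hS.map_of_exact G)
  δ_naturality n S S' φ hS hS' :=
    D.δ_naturality n (G.mapShortComplex.map φ) (hS.map_of_exact G) (hS'.map_of_exact G)
  map_comp_δ n S hS := D.map_comp_δ n (S.map G) (hS.map_of_exact G)
  δ_comp_map n S hS := D.δ_comp_map n (S.map G) (hS.map_of_exact G)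

/-- Postcomposition of a `∂`-functor with an additive functor. -/
def postcomp (D : HomologicalDeltaFunctor B C) {C' : Type*} [Category C'] [Abelian C']
    (H : C ⥤ C') [H.Additive] : HomologicalDeltaFunctor B C' where
  L n := D.L n ⋙ H
  additive n := by
    have := D.additive n
    infer_instance
  δ n S hS := H.map (D.δ n S hS)
  δ_naturality n S S' φ hS hS' := by
    refine (H.map_comp _ _).symm.trans (Eq.trans ?_ (H.map_comp _ _))
    exact congrArg H.map (D.δ_naturality n φ hS hS')
  map_comp_δ n S hS := by
    refine (H.map_comp _ _).symm.trans (Eq.trans ?_ (H.map_zero _ _))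
    exact congrArg H.map (D.map_comp_δ n S hS)
  δ_comp_map n S hS := by
    refine (H.map_comp _ _).symm.trans (Eq.trans ?_ (H.map_zero _ _))
    exact congrArg H.map (D.δ_comp_map n S hS)

end HomologicalDeltaFunctor

/-- The left satellites of a functor `F`: a universal homological `∂`-functor `(L_q F)_{q ≥ 0}` with
an identification `L_0 F ≅ F`.  They are unique up to unique isomorphism. -/
structure LeftSatellites {B : Type*} [Category B] [Abelian B] {C : Type*} [Category C] [Abelian C]
    (F : B ⥤ C) extends HomologicalDeltaFunctor B C where
  isUniversal : toHomologicalDeltaFunctor.IsUniversal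
  /-- the identification in degree zero -/
  iso₀ : L 0 ≅ F

end Satellites

/-! ### Convergence of first quadrant homology spectral sequences -/

section SpectralSequences

/-- First quadrant homology spectral sequences `E^r_{p,q}`, `r ≥ 2`, `p, q ≥ 0`, with differentials
`d^r : E^r_{p,q} ⟶ E^r_{p-r,q+r-1}`. -/
abbrev E2HomologicalSpectralSequenceNat (A : Type w) [Category.{v} A] [Abelian A] :=
  SpectralSequence A (fun r : ℤ => ComplexShape.spectralSequenceNat (⟨-r, r - 1⟩ : ℤ × ℤ)) 2

/-- For `r ≥ p + q + 2` no differential of the `r`-th page starts or ends at `(p, q)`, so that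
`E^r_{p,q}` is the limit term `E^∞_{p,q}`. -/
theorem spectralSequenceNat_not_rel (p q : ℕ) (r : ℤ) (hr : (p : ℤ) + q + 2 ≤ r) (x : ℕ × ℕ) :
    ¬ (ComplexShape.spectralSequenceNat (⟨-r, r - 1⟩ : ℤ × ℤ)).Rel (p, q) x ∧
      ¬ (ComplexShape.spectralSequenceNat (⟨-r, r - 1⟩ : ℤ × ℤ)).Rel x (p, q) := by
  simp only [ComplexShape.spectralSequenceNat_rel_iff]
  constructor <;> rintro ⟨h₁, h₂⟩ <;> lia

variable {A : Type w} [Category.{v} A] [Abelian A]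

/-- The term `E^2_{p,q}`. -/
def E2HomologicalSpectralSequenceNat.secondPage (E : E2HomologicalSpectralSequenceNat A)
    (p q : ℕ) : A :=
  (E.page 2).X (p, q)

/-- The map of `E^2`-terms induced by a morphism of spectral sequences. -/
def E2HomologicalSpectralSequenceNat.secondPageMap {E E' : E2HomologicalSpectralSequenceNat A}
    (φ : E ⟶ E') (p q : ℕ) : E.secondPage p q ⟶ E'.secondPage p q :=
  (φ.hom 2).f (p, q)

/-- The limit term `E^∞_{p,q} = E^{p+q+2}_{p,q}`. -/
def E2HomologicalSpectralSequenceNat.limitTerm (E : E2HomologicalSpectralSequenceNat A)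
    (p q : ℕ) : A :=
  (E.page ((p : ℤ) + q + 2)).X (p, q)

/-- The map of limit terms induced by a morphism of spectral sequences. -/
def E2HomologicalSpectralSequenceNat.limitTermMap {E E' : E2HomologicalSpectralSequenceNat A}
    (φ : E ⟶ E') (p q : ℕ) : E.limitTerm p q ⟶ E'.limitTerm p q :=
  (φ.hom ((p : ℤ) + q + 2)).f (p, q)

/-- Convergence `E^2_{p,q} ⇒ H_{p+q}`: each `H n` has a filtration
`0 = F_{-1} ≤ F_0 ≤ ... ≤ F_n = H n` with `F_p / F_{p-1} ≅ E^∞_{p,n-p}`.  Here `fil n k` is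
`F_{k-1}`, and the isomorphism is given by a short exact sequence
`0 ⟶ F_{p-1} ⟶ F_p ⟶ E^∞_{p,q} ⟶ 0`, where `p + q = n`. -/
structure Convergence (E : E2HomologicalSpectralSequenceNat A) (H : ℕ → A) where
  /-- the filtration, shifted by one -/
  fil : ∀ n : ℕ, ℕ → Subobject (H n)
  mono : ∀ n, Monotone (fil n)
  fil_zero : ∀ n, fil n 0 = ⊥
  fil_top : ∀ n, fil n (n + 1) = ⊤
  /-- the projection of `F_p` onto the limit term -/
  proj : ∀ p q : ℕ, (fil (p + q) (p + 1) : A) ⟶ E.limitTerm p q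
  ofLE_proj : ∀ p q : ℕ,
    Subobject.ofLE (fil (p + q) p) (fil (p + q) (p + 1)) (mono _ (Nat.le_succ p)) ≫ proj p q = 0
  shortExact : ∀ p q : ℕ, (ShortComplex.mk _ (proj p q) (ofLE_proj p q)).ShortExact

/-- A morphism of spectral sequences and maps of the abutments are compatible if the maps of the
abutments preserve the filtrations and induce on the graded pieces the maps of the limit terms. -/
def Convergence.Compatible {E E' : E2HomologicalSpectralSequenceNat A} {H H' : ℕ → A}
    (c : Convergence E H) (c' : Convergence E' H') (φ : E ⟶ E') (h : ∀ n, H n ⟶ H' n) : Prop :=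
  ∀ p q : ℕ, ∃ a : (c.fil (p + q) (p + 1) : A) ⟶ (c'.fil (p + q) (p + 1) : A),
    a ≫ (c'.fil (p + q) (p + 1)).arrow = (c.fil (p + q) (p + 1)).arrow ≫ h (p + q) ∧
    a ≫ c'.proj p q =
      c.proj p q ≫ E2HomologicalSpectralSequenceNat.limitTermMap φ p q

end SpectralSequences

/-! ### Left Kan extensions between simplex categories -/

namespace GabrielZisman

section Kan

instance hasLeftKanExtension_opSimplicesMap {A : Type w} [Category.{v} A]
    [HasColimitsOfSize.{u, u} A] {X Y : SSet.{u}} (f : X ⟶ Y) (T : OpSimplices X ⥤ A) :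
    (opSimplicesMap f).HasLeftKanExtension T := by
  have : HasColimitsOfSize.{0, u} A := hasColimitsOfSizeOfUnivLE.{u, u, 0, u} A
  infer_instance

/-- A commutative square `f' ∘ g = h ∘ f` of simplicial sets induces a square of simplex categories
that commutes up to the identity maps. -/
def opSimplicesSquareIso {X Y X' Y' : SSet.{u}} (f : X ⟶ Y) (f' : X' ⟶ Y') (g : X ⟶ X')
    (h : Y ⟶ Y') (w : g ≫ f' = f ≫ h) :
    opSimplicesMap g ⋙ opSimplicesMap f' ≅ opSimplicesMap f ⋙ opSimplicesMap h :=
  NatIso.ofComponents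
    (fun x => CategoryOfElements.isoMk _ _ (Iso.refl x.1) (by
      refine (ConcreteCategory.congr_hom (Y'.map_id x.1) _).trans ?_
      exact ConcreteCategory.congr_hom (NatTrans.congr_app w x.1) x.2))
    (fun {x y} k => CategoryOfElements.ext _ _ _
      ((Category.comp_id k.1).trans (Category.id_comp k.1).symm))

variable (A : Type w) [Category.{v} A]

/-- Restriction of natural systems along `(Δ/f)ᵒᵖ`. -/
abbrev res {X Y : SSet.{u}} (f : X ⟶ Y) : (OpSimplices Y ⥤ A) ⥤ (OpSimplices X ⥤ A) :=
  (Functor.whiskeringLeft _ _ A).obj (opSimplicesMap f)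

/-- For a commutative square `f' ∘ g = h ∘ f`, the canonical identification of the two restrictions
along the square. -/
def resSquareIso {X Y X' Y' : SSet.{u}} (f : X ⟶ Y) (f' : X' ⟶ Y') (g : X ⟶ X') (h : Y ⟶ Y')
    (w : g ≫ f' = f ≫ h) : res A f' ⋙ res A g ≅ res A h ⋙ res A f :=
  NatIso.ofComponents
    (fun M => Functor.isoWhiskerRight (opSimplicesSquareIso f f' g h w) M)
    (fun {M N} α => by
      ext x
      exact (α.naturality ((opSimplicesSquareIso f f' g h w).hom.app x)).symm)

variable [HasColimitsOfSize.{u, u} A]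

/-- The left Kan extension functor along `(Δ/f)ᵒᵖ : (Δ/X)ᵒᵖ ⥤ (Δ/Y)ᵒᵖ`. -/
noncomputable abbrev lan {X Y : SSet.{u}} (f : X ⟶ Y) :
    (OpSimplices X ⥤ A) ⥤ (OpSimplices Y ⥤ A) :=
  (opSimplicesMap f).lan

/-- For a commutative square `f' ∘ g = h ∘ f`, the canonical (base change) transformation
`Lan_f (g^* T') ⟶ h^* (Lan_{f'} T')`, i.e. the mate of `g^* f'^* ≅ f^* h^*`. -/
noncomputable def lanBaseChange {X Y X' Y' : SSet.{u}} (f : X ⟶ Y) (f' : X' ⟶ Y') (g : X ⟶ X')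
    (h : Y ⟶ Y') (w : g ≫ f' = f ≫ h) : res A g ⋙ lan A f ⟶ lan A f' ⋙ res A h :=
  ((mateEquiv ((opSimplicesMap f').lanAdjunction A) ((opSimplicesMap f).lanAdjunction A)).symm
    (TwoSquare.mk _ _ _ _ (resSquareIso A f f' g h w).hom)).natTrans

end Kan

section Comparison

variable {A : Type w} [Category.{v} A] [Abelian A] [HasColimitsOfSize.{u, u} A]

/-- For a commutative square `f' ∘ g = h ∘ f` and left satellites of `Lan_f` and `Lan_{f'}`, a
morphism of `∂`-functors `L_q Lan_f (g^* -) ⟶ h^* (L_q Lan_{f'} (-))`, `q ≥ 0`, that in degree zero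
is the canonical transformation `Lan_f (g^* -) ⟶ h^* (Lan_{f'} (-))`. -/
structure SatelliteComparison {X Y X' Y' : SSet.{u}} {f : X ⟶ Y} {f' : X' ⟶ Y'}
    (S : LeftSatellites (lan A f)) (S' : LeftSatellites (lan A f')) (g : X ⟶ X') (h : Y ⟶ Y')
    (w : g ≫ f' = f ≫ h) extends
    HomologicalDeltaFunctor.Hom (S.toHomologicalDeltaFunctor.precomp (res A g))
      (S'.toHomologicalDeltaFunctor.postcomp (res A h)) where
  app_zero : app 0 ≫ Functor.whiskerRight S'.iso₀.hom (res A h) =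
    Functor.whiskerLeft (res A g) S.iso₀.hom ≫ lanBaseChange A f f' g h w

end Comparison

section Leray

/-- The category of maps of simplicial sets with coefficients.  Its objects are maps
`f : X ⟶ Y` of simplicial sets with a contravariant natural system `T` on `X`.  A morphism
`(f : X ⟶ Y, T) ⟶ (f' : X' ⟶ Y', T')` consists of `g : X ⟶ X'`, `h : Y ⟶ Y'` with
`f' ∘ g = h ∘ f` and `τ : T ⟶ T' ∘ (Δ/g)ᵒᵖ`. -/
abbrev MapWithCoeff (A : Type w) [Category.{v} A] :=
  Comma (NatSystem.toSSet.{w, v, u} A) (𝟭 SSet.{u})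

variable {A : Type w} [Category.{v} A]

/-- The map of simplicial sets that underlies an object. -/
abbrev MapWithCoeff.f (c : MapWithCoeff.{w, v, u} A) : c.left.X ⟶ c.right := c.hom

variable [Abelian A] [HasColimitsOfSize.{u, u} A]

/-- The natural system `(Y, L_q ((Δ/f)ᵒᵖ)_* T)`, for a choice `S` of left satellites. -/
def satelliteSystem
    (S : ∀ {X Y : SSet.{u}} (f : X ⟶ Y), LeftSatellites (lan A f))
    (q : ℕ) (c : MapWithCoeff.{w, v, u} A) : NatSystem.{w, v, u} A where
  X := c.right
  T := ((S c.f).L q).obj c.left.T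

/-- The morphism of natural systems `(Y, L_q Lan_f T) ⟶ (Y', L_q Lan_{f'} T')` induced by a morphism
`(g, h, τ)`: it is `h` together with the composite
`L_q Lan_f T ⟶ L_q Lan_f (g^* T') ⟶ h^* (L_q Lan_{f'} T')` of the map induced by `τ` and of the
comparison map of satellites. -/
def satelliteSystemMap
    (S : ∀ {X Y : SSet.{u}} (f : X ⟶ Y), LeftSatellites (lan A f))
    (q : ℕ) {c c' : MapWithCoeff.{w, v, u} A} (m : c ⟶ c')
    (κ : SatelliteComparison (S c.f) (S c'.f) m.left.φ m.right m.w) :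
    satelliteSystem S q c ⟶ satelliteSystem S q c' :=
  NatSystem.Hom.mk m.right (((S c.f).L q).map m.left.τ ≫ (κ.app q).app c'.left.T)

end Leray

end GabrielZisman

/-!
The functor `(Δ/f)ᵒᵖ` is a discrete opfibration: a simplex `x` over `y` and an operator `θ` determine
the simplex `X(θ)(x)` over `Y(θ)(y)`.  Hence the left Kan extension along it is the coproduct over
the fibres, `(Lan_f T)(y) = ⨁_{f x = y} T(x)`, which is exact when coproducts are.  So every choice
of left satellites vanishes in positive degrees, and `C_*(X, T) ≅ C_*(Y, Lan_f T)`.  The terms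
`E^2_{p,q}` with `q > 0` are therefore zero, and the edge maps are isomorphisms.
-/

/-! ### Satellites of functors that preserve monomorphisms -/

namespace HomologicalDeltaFunctor

open scoped ZeroObject

variable {B : Type*} [Category B] [Abelian B] {C : Type*} [Category C] [Abelian C]

/-! The spectral sequence degenerates. A simplex of the comma category of `y` is an operator `f x ⟶
y`, and it maps canonically to the unique simplex over `y` that lifts it, so the colimit computing
the Kan extension at `y` collapses to the coproduct over the fibre (`isColimitFibreCofan`). AB4 then
makes `Lan_f` preserve monomorphisms.

An additive functor that preserves monomorphisms, followed by zeros, is a universal `∂`-functor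
(`concentrated_isUniversal`). By uniqueness of satellites, any choice of them vanishes in positive
degrees, so the rows `q > 0` of the second page are zero.

In the row `q = 0`, regrouping the sum over `X_n` by fibres gives `⨁_{x ∈ X_n} T(x) = ⨁_{y ∈ Y_n}
(Lan_f T)(y)` compatibly with all operators, so the Kan extension unit induces an isomorphism
`H_p(X, T) ≅ H_p(Y, Lan_f T)` (`isIso_homology_map`). Thus a spectral sequence with zero
differentials and `H_p(X, T)` in its bottom row serves as `E`.

What remains is naturality: the edge isomorphism must be compatible with the base change
transformation. This is the unit formula for mates, transported along the identifications of `L_0`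
with `Lan` (`satelliteUnit_comp_comparison`). -/

/-- The identity morphism of a `∂`-functor. -/
def Hom.id (D : HomologicalDeltaFunctor B C) : Hom D D where
  app n := 𝟙 (D.L n)
  comm _ _ _ := (Category.id_comp _).trans (Category.comp_id _).symm

/-- The composition of morphisms of `∂`-functors. -/
def Hom.comp {D D' D'' : HomologicalDeltaFunctor B C} (a : Hom D D') (b : Hom D' D'') :
    Hom D D'' where
  app n := a.app n ≫ b.app n
  comm n S hS := by
    rw [NatTrans.comp_app, NatTrans.comp_app, Category.assoc, b.comm, ← Category.assoc, a.comm,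
      Category.assoc]

/-- The functors of the `∂`-functor that is `F` in degree zero and vanishes in higher degrees. -/
noncomputable def concentratedFunctor (F : B ⥤ C) : ℕ → B ⥤ C
  | 0 => F
  | _ + 1 => (Functor.const B).obj 0

/-- An additive functor, viewed as a `∂`-functor that vanishes in positive degrees. -/
noncomputable def concentrated (F : B ⥤ C) [F.Additive] : HomologicalDeltaFunctor B C where
  L := concentratedFunctor F
  additive n := match n with
    | 0 => inferInstanceAs F.Additive
    | _ + 1 => ⟨fun {_ _ _ _} => (isZero_zero C).eq_of_src _ _⟩
  δ _ _ _ := 0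
  δ_naturality _ _ _ _ _ _ := comp_zero.trans zero_comp.symm
  map_comp_δ _ _ _ := comp_zero
  δ_comp_map _ _ _ := zero_comp

/-- All higher components are forced to be zero, so only the square from degree 1 to degree 0 is at
stake: `δ ≫ α` must vanish. It does after composition with the monomorphism `F(X₁) ⟶ F(X₂)`, since
naturality of `α` turns that composite into one starting with `δ ≫ D₀(f) = 0`. -/
theorem concentrated_isUniversal (F : B ⥤ C) [F.Additive] [F.PreservesMonomorphisms] :
    (concentrated F).IsUniversal := by
  have hz (n : ℕ) (Z : B) : IsZero (((concentrated F).L (n + 1)).obj Z) := isZero_zero C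
  intro D α
  refine ⟨⟨fun n => match n with
      | 0 => α
      | n + 1 => { app := fun Z => 0
                   naturality := fun _ Z _ => (hz n Z).eq_of_tgt _ _ }, ?_⟩, rfl, ?_⟩
  · rintro (_ | n) S hS
    · have := hS.mono_f
      have : Mono (((concentrated F).L 0).map S.f) := inferInstanceAs (Mono (F.map S.f))
      rw [← cancel_mono (((concentrated F).L 0).map S.f), Category.assoc, Category.assoc]
      refine Eq.trans ?_ (congrArg (D.δ 0 S hS ≫ ·) (α.naturality S.f))
      dsimp only
      rw [zero_comp, ← Category.assoc, D.δ_comp_map, zero_comp]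
    · exact (hz n _).eq_of_tgt _ _
  · rintro φ hφ
    refine Hom.ext (funext fun n => ?_)
    match n with
    | 0 => exact hφ
    | n + 1 => ext Z; exact (hz n Z).eq_of_tgt _ _

end HomologicalDeltaFunctor

namespace LeftSatellites

variable {B : Type*} [Category B] [Abelian B] {C : Type*} [Category C] [Abelian C]

/-- The left satellites of an additive functor that preserves monomorphisms vanish in positive
degrees. -/
noncomputable def ofPreservesMonomorphisms (F : B ⥤ C) [F.Additive]
    [F.PreservesMonomorphisms] : LeftSatellites F where
  toHomologicalDeltaFunctor := .concentrated F
  isUniversal := HomologicalDeltaFunctor.concentrated_isUniversal F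
  iso₀ := Iso.refl F

/-- Two choices of left satellites are identified by a pair of morphisms of `∂`-functors that
compose to the identity. -/
theorem exists_comp_eq_id {F : B ⥤ C} (S S' : LeftSatellites F) :
    ∃ (a : S.toHomologicalDeltaFunctor.Hom S'.toHomologicalDeltaFunctor)
      (b : S'.toHomologicalDeltaFunctor.Hom S.toHomologicalDeltaFunctor),
      a.comp b = .id _ := by
  obtain ⟨a, ha, -⟩ := S'.isUniversal S.toHomologicalDeltaFunctor (S.iso₀.hom ≫ S'.iso₀.inv)
  obtain ⟨b, hb, -⟩ := S.isUniversal S'.toHomologicalDeltaFunctor (S'.iso₀.hom ≫ S.iso₀.inv)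
  refine ⟨a, b, (S.isUniversal _ (𝟙 _)).unique ?_ rfl⟩
  change a.app 0 ≫ b.app 0 = 𝟙 _
  simp [ha, hb]

/-- By uniqueness of satellites, the identity in degree `n + 1` factors through the concentrated
model, which is zero there. -/
theorem isZero_of_preservesMonomorphisms {F : B ⥤ C} [F.Additive] [F.PreservesMonomorphisms]
    (S : LeftSatellites F) (n : ℕ) (Z : B) : IsZero ((S.L (n + 1)).obj Z) := by
  obtain ⟨a, b, h⟩ := exists_comp_eq_id S (ofPreservesMonomorphisms F)
  have hz : IsZero (((ofPreservesMonomorphisms F).L (n + 1)).obj Z) := isZero_zero C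
  have h' : (a.app (n + 1)).app Z ≫ (b.app (n + 1)).app Z = 𝟙 _ :=
    NatTrans.congr_app (congrFun (congrArg HomologicalDeltaFunctor.Hom.app h) (n + 1)) Z
  rw [IsZero.iff_id_eq_zero, ← h', hz.eq_of_tgt ((a.app (n + 1)).app Z) 0, zero_comp]

end LeftSatellites

/-! ### Left Kan extensions as fibrewise coproducts -/

namespace GabrielZisman

section Fibre

variable {A : Type w} [Category.{v} A] {X Y : SSet.{u}} (f : X ⟶ Y)

/-- The simplices of `X` over a given simplex of `Y`. -/
abbrev Fibre (y : OpSimplices Y) : Type u := {x : X.obj y.1 // f.app y.1 x = y.2}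

namespace Fibre

variable {f} {y : OpSimplices Y}

/-- A simplex of the fibre, as an object of the category of simplices. -/
abbrev simplex (x : Fibre f y) : OpSimplices X := X.elementsMk y.1 x.1

/-- The identification of the image of a simplex of the fibre with the given simplex. -/
def toBase (x : Fibre f y) : (opSimplicesMap f).obj x.simplex ⟶ y :=
  CategoryOfElements.homMk _ _ (𝟙 y.1) ((ConcreteCategory.congr_hom (Y.map_id y.1) _).trans x.2)

/-- The unique lift of a morphism of `Y` with a given source in `X`: the functor `(Δ/f)ᵒᵖ` is a
discrete opfibration. -/
def lift (a : CostructuredArrow (opSimplicesMap f) y) : Fibre f y :=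
  ⟨X.map a.hom.1 a.left.2, (NatTrans.naturality_apply f a.hom.1 a.left.2).trans a.hom.2⟩

/-- The morphism that the unique lift of a morphism of `Y` gives. -/
def toLift (a : CostructuredArrow (opSimplicesMap f) y) : a.left ⟶ (lift a).simplex :=
  CategoryOfElements.homMk _ _ a.hom.1 rfl

/-- A morphism of simplices is determined by its source and its operator, and so is its target. This
replaces transport along equalities of simplices that are not definitional. -/
theorem map_comp_congr {T : OpSimplices X ⥤ A} {Z : A}
    (s : ∀ x : Fibre f y, T.obj x.simplex ⟶ Z) {x₀ : OpSimplices X} (x x' : Fibre f y)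
    (k : x₀ ⟶ x.simplex) (k' : x₀ ⟶ x'.simplex) (h : k.1 = k'.1) :
    T.map k ≫ s x = T.map k' ≫ s x' := by
  obtain rfl : x = x' := Subtype.ext (by
    rw [← show X.map k.1 x₀.2 = x.1 from k.2, h]
    exact k'.2)
  rw [show k = k' from Subtype.ext h]

end Fibre

open Fibre

variable {f} {T : OpSimplices X ⥤ A} {T' : OpSimplices Y ⥤ A} (τ : T ⟶ opSimplicesMap f ⋙ T')

/-- The map `T(x) ⟶ T'(y)` for a simplex `x` over `y`. -/
def fibreMap (y : OpSimplices Y) (x : Fibre f y) : T.obj x.simplex ⟶ T'.obj y :=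
  τ.app x.simplex ≫ T'.map x.toBase

/-- The cofan with summands `T(x)`, where `x` runs over the simplices over `y`. -/
def fibreCofan (y : OpSimplices Y) : Cofan fun x : Fibre f y => T.obj x.simplex :=
  Cofan.mk (T'.obj y) (fibreMap τ y)

/-- Every leg of the Kan extension cocone factors through the leg at a simplex of the fibre; this
yields uniqueness in `isColimitFibreCofan`. -/
theorem toLift_fibreMap (y : OpSimplices Y) (a : CostructuredArrow (opSimplicesMap f) y) :
    T.map (toLift a) ≫ fibreMap τ y (lift a) = τ.app a.left ≫ T'.map a.hom := by
  dsimp only [fibreMap]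
  rw [← Category.assoc, τ.naturality, Category.assoc]
  refine congrArg (τ.app a.left ≫ ·) ((T'.map_comp _ _).symm.trans (congrArg T'.map ?_))
  exact CategoryOfElements.ext _ _ _ (Category.comp_id _)

/-- A cocone over the simplices over `y` extends to the comma category of `y`. -/
def costructuredArrowCocone (y : OpSimplices Y) {Z : A}
    (s : ∀ x : Fibre f y, T.obj x.simplex ⟶ Z) :
    Cocone (CostructuredArrow.proj (opSimplicesMap f) y ⋙ T) where
  pt := Z
  ι :=
    { app := fun a => T.map (toLift a) ≫ s (lift a)
      naturality := fun a b k => by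
        refine Eq.trans ?_ (Category.comp_id _).symm
        refine (Category.assoc _ _ _).symm.trans
          ((congrArg (· ≫ _) (T.map_comp k.left (toLift b)).symm).trans ?_)
        exact map_comp_congr s _ _ _ _ (congrArg Subtype.val (CostructuredArrow.w k)) }

variable [HasColimitsOfSize.{u, u} A]

instance (y : OpSimplices Y) :
    (opSimplicesMap f).HasPointwiseLeftKanExtensionAt T y := by
  have : HasColimitsOfSize.{0, u} A := hasColimitsOfSizeOfUnivLE.{u, u, 0, u} A
  infer_instance

/-- The left Kan extension along `(Δ/f)ᵒᵖ` is the coproduct over the fibres. -/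
noncomputable def isColimitFibreCofan [T'.IsLeftKanExtension τ] (y : OpSimplices Y) :
    IsColimit (fibreCofan τ y) :=
  have hc : IsColimit ((Functor.LeftExtension.mk T' τ).coconeAt y) :=
    Functor.isPointwiseLeftKanExtensionOfIsLeftKanExtension T' τ y
  Cofan.IsColimit.mk _ (fun s => hc.desc (costructuredArrowCocone y s.inj))
    (fun s x => by
      refine (hc.fac (costructuredArrowCocone y s.inj) (CostructuredArrow.mk x.toBase)).trans ?_
      -- The lift of `x.toBase` is `X(𝟙)(x)`, which equals `x` only propositionally; both morphisms
      -- have the identity as operator.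
      refine (map_comp_congr s.inj (lift (CostructuredArrow.mk x.toBase)) x (toLift _) (𝟙 _)
        rfl).trans ?_
      exact (congrArg (· ≫ _) (T.map_id _)).trans (Category.id_comp _))
    (fun s m hm => hc.hom_ext fun a => by
      refine Eq.trans ?_ (hc.fac (costructuredArrowCocone y s.inj) a).symm
      refine (congrArg (· ≫ m) (toLift_fibreMap τ y a).symm).trans ?_
      exact (Category.assoc _ _ _).trans (congrArg (T.map (toLift a) ≫ ·) (hm _)))

end Fibre

/-! ### Preservation of monomorphisms by the left Kan extension -/

section Exact

variable {A : Type w} [Category.{v} A] [Abelian A] [HasColimitsOfSize.{u, u} A]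

/-- This is where exactness of coproducts enters; arbitrary colimit cofans are allowed so that it
applies to the values of a Kan extension. -/
theorem mono_of_isColimit_cofan [AB4OfSize.{u} A] {J : Type u} {F G : J → A} {c : Cofan F}
    {d : Cofan G} (hc : IsColimit c) (hd : IsColimit d) (a : ∀ j, F j ⟶ G j) [∀ j, Mono (a j)]
    (m : c.pt ⟶ d.pt) (h : ∀ j, c.inj j ≫ m = a j ≫ d.inj j) : Mono m := by
  have (j : Discrete J) : Mono ((Discrete.natTrans fun j => a j.as :
      Discrete.functor F ⟶ Discrete.functor G).app j) := inferInstanceAs (Mono (a j.as))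
  have := NatTrans.mono_of_mono_app (Discrete.natTrans fun j => a j.as :
      Discrete.functor F ⟶ Discrete.functor G)
  exact colim.map_mono' (Discrete.natTrans fun j => a j.as :
      Discrete.functor F ⟶ Discrete.functor G) hc hd m fun j => h j.as

instance {X Y : SSet.{u}} (f : X ⟶ Y) : (lan A f).Additive :=
  ((opSimplicesMap f).lanAdjunction A).left_adjoint_additive

/-- Under the fibrewise description, `Lan_f η` at `y` is the coproduct of the maps `η_x` over the
fibre. -/
theorem fibreMap_lanUnit_naturality {A : Type w} [Category.{v} A]
    [HasColimitsOfSize.{u, u} A] {X Y : SSet.{u}} (f : X ⟶ Y) {T T' : OpSimplices X ⥤ A}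
    (η : T ⟶ T') (y : OpSimplices Y) (x : Fibre f y) :
    fibreMap ((opSimplicesMap f).lanUnit.app T) y x ≫ ((lan A f).map η).app y =
      η.app x.simplex ≫ fibreMap ((opSimplicesMap f).lanUnit.app T') y x := by
  have h := NatTrans.congr_app ((opSimplicesMap f).lanUnit.naturality η) x.simplex
  dsimp only [fibreMap]
  rw [Category.assoc, ((lan A f).map η).naturality, ← Category.assoc, ← Category.assoc]
  exact congrArg (· ≫ _) h.symm

instance [AB4OfSize.{u} A] {X Y : SSet.{u}} (f : X ⟶ Y) :
    (lan A f).PreservesMonomorphisms where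
  preserves η _ := by
    have (y : OpSimplices Y) : Mono (((lan A f).map η).app y) :=
      mono_of_isColimit_cofan (isColimitFibreCofan ((opSimplicesMap f).lanUnit.app _) y)
        (isColimitFibreCofan ((opSimplicesMap f).lanUnit.app _) y)
        (fun x => η.app x.simplex) _ (fibreMap_lanUnit_naturality f η y)
    exact NatTrans.mono_of_mono_app _

end Exact

/-! ### Invariance of Gabriel-Zisman homology under left Kan extension -/

section Replacement

variable {A : Type w} [Category.{v} A] [HasColimitsOfSize.{u, u} A]

/-- The inclusion of a summand into the simplicial replacement. -/
noncomputable def replacementι (S : NatSystem.{w, v, u} A) {n : SimplexCategoryᵒᵖ}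
    (σ : S.X.obj n) : S.T.obj (S.X.elementsMk n σ) ⟶ (simplicialReplacement S).obj n :=
  Sigma.ι (fun σ : S.X.obj n => S.T.obj (S.X.elementsMk n σ)) σ

theorem replacement_hom_ext (S : NatSystem.{w, v, u} A) {n : SimplexCategoryᵒᵖ} {Z : A}
    {k l : (simplicialReplacement S).obj n ⟶ Z}
    (h : ∀ σ : S.X.obj n, replacementι S σ ≫ k = replacementι S σ ≫ l) : k = l :=
  Sigma.hom_ext _ _ h

/-- Maps out of the simplicial replacement are given by maps out of the summands. -/
noncomputable def replacementDesc (S : NatSystem.{w, v, u} A) {n : SimplexCategoryᵒᵖ} {Z : A}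
    (k : ∀ σ : S.X.obj n, S.T.obj (S.X.elementsMk n σ) ⟶ Z) :
    (simplicialReplacement S).obj n ⟶ Z :=
  Sigma.desc k

theorem replacementι_desc (S : NatSystem.{w, v, u} A) {n : SimplexCategoryᵒᵖ} {Z : A}
    (k : ∀ σ : S.X.obj n, S.T.obj (S.X.elementsMk n σ) ⟶ Z) (σ : S.X.obj n) :
    replacementι S σ ≫ replacementDesc S k = k σ :=
  Sigma.ι_desc k σ

theorem replacementι_map {S S' : NatSystem.{w, v, u} A} (a : S ⟶ S') {n : SimplexCategoryᵒᵖ}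
    (σ : S.X.obj n) : replacementι S σ ≫ (simplicialReplacementMap a).app n =
      a.τ.app (S.X.elementsMk n σ) ≫ replacementι S' (a.φ.app n σ) :=
  replacementι_desc S (fun σ => NatSystem.Hom.at a σ ≫ replacementι S' (a.φ.app n σ)) σ

theorem fibreMap_replacementι {S S' : NatSystem.{w, v, u} A} (a : S ⟶ S')
    {n : SimplexCategoryᵒᵖ} (y : S'.X.obj n) (x : Fibre a.φ (S'.X.elementsMk n y)) :
    fibreMap a.τ (S'.X.elementsMk n y) x ≫ replacementι S' y =
      replacementι S x.1 ≫ (simplicialReplacementMap a).app n := by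
  -- With `y` free, it can be replaced by the image of `x`; then `toBase` is an identity.
  have h : ∀ (x : S.X.obj n) (y : S'.X.obj n) (hx : a.φ.app n x = y),
      fibreMap a.τ (S'.X.elementsMk n y) ⟨x, hx⟩ ≫ replacementι S' y =
        replacementι S x ≫ (simplicialReplacementMap a).app n := by
    rintro x _ rfl
    refine Eq.trans ?_ (replacementι_map a x).symm
    exact congrArg (· ≫ replacementι S' (a.φ.app n x))
      ((congrArg (a.τ.app (S.X.elementsMk n x) ≫ ·) (S'.T.map_id _)).trans (Category.comp_id _))
  exact h x.1 y x.2

variable {S S' : NatSystem.{w, v, u} A} (a : S ⟶ S') [S'.T.IsLeftKanExtension a.τ]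

/-- The inverse of the map of simplicial replacements induced by a left Kan extension. -/
noncomputable def simplicialReplacementInv (n : SimplexCategoryᵒᵖ) :
    (simplicialReplacement S').obj n ⟶ (simplicialReplacement S).obj n :=
  replacementDesc S' fun y => Cofan.IsColimit.desc (isColimitFibreCofan a.τ (S'.X.elementsMk n y))
    fun x => replacementι S x.1

theorem fibreMap_simplicialReplacementInv {n : SimplexCategoryᵒᵖ} (y : S'.X.obj n)
    (x : Fibre a.φ (S'.X.elementsMk n y)) :
    fibreMap a.τ (S'.X.elementsMk n y) x ≫ replacementι S' y ≫ simplicialReplacementInv a n =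
      replacementι S x.1 := by
  have h : replacementι S' y ≫ simplicialReplacementInv a n =
      Cofan.IsColimit.desc (isColimitFibreCofan a.τ (S'.X.elementsMk n y))
        fun x => replacementι S x.1 := replacementι_desc S' _ y
  rw [h]
  exact Cofan.IsColimit.fac (isColimitFibreCofan a.τ (S'.X.elementsMk n y)) _ x

/-- The sum over `X_n` is regrouped by fibres over `Y_n`. Both composites are tested on the summands
`T(x)`: on the side of `Y`, these jointly detect maps out of each `T'(y)`. -/
theorem isIso_simplicialReplacementMap_app (n : SimplexCategoryᵒᵖ) :
    IsIso ((simplicialReplacementMap a).app n) := by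
  refine ⟨simplicialReplacementInv a n, replacement_hom_ext S fun x => ?_,
    replacement_hom_ext S' fun y => Cofan.IsColimit.hom_ext
      (isColimitFibreCofan a.τ (S'.X.elementsMk n y)) _ _ fun x => ?_⟩
  · rw [Category.comp_id, ← Category.assoc,
      ← fibreMap_replacementι a (a.φ.app n x) ⟨x, rfl⟩, Category.assoc]
    exact fibreMap_simplicialReplacementInv a _ ⟨x, rfl⟩
  · change fibreMap a.τ _ x ≫ _ = fibreMap a.τ _ x ≫ _
    rw [Category.comp_id, fibreMap_replacementι, ← fibreMap_simplicialReplacementInv a y x]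
    simp only [Category.assoc]

theorem isIso_homology_map {A : Type w} [Category.{v} A] [Abelian A]
    [HasColimitsOfSize.{u, u} A] {S S' : NatSystem.{w, v, u} A} (a : S ⟶ S')
    [S'.T.IsLeftKanExtension a.τ] (p : ℕ) : IsIso ((homology p).map a) := by
  have := isIso_simplicialReplacementMap_app a
  have : IsIso (simplicialReplacementMap a) := NatIso.isIso_of_isIso_app _
  exact inferInstanceAs (IsIso ((AlgebraicTopology.alternatingFaceMapComplex A ⋙
    HomologicalComplex.homologyFunctor A _ p).map (simplicialReplacementMap a)))

end Replacement

end GabrielZisman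

/-! ### Spectral sequences concentrated in the bottom row -/

namespace HomologicalComplex

variable {A : Type w} [Category.{v} A] [Abelian A] {κ : Type*} (c : ComplexShape κ)

/-- The complex with the given objects and zero differentials. -/
noncomputable def zeroDifferential (X : κ → A) : HomologicalComplex A c where
  X := X
  d _ _ := 0

theorem zeroDifferential_d (X : κ → A) (i j : κ) : (zeroDifferential c X).d i j = 0 := rfl

/-- The morphism of complexes with zero differentials given by maps of the objects. -/
noncomputable def zeroDifferentialMap {X X' : κ → A} (h : ∀ i, X i ⟶ X' i) :
    zeroDifferential c X ⟶ zeroDifferential c X' where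
  f := h
  comm' _ _ _ := comp_zero.trans zero_comp.symm

/-- The homology of a complex with zero differentials. -/
noncomputable def zeroDifferentialHomologyIso (X : κ → A) (i : κ) :
    (zeroDifferential c X).homology i ≅ (zeroDifferential c X).X i :=
  ((zeroDifferential c X).isoHomologyπ _ i rfl (zeroDifferential_d c X _ _)).symm ≪≫
    (zeroDifferential c X).iCyclesIso i _ rfl (zeroDifferential_d c X _ _)

/-- After precomposition with the epimorphism from cycles to homology, the isomorphism becomes the
inclusion of cycles, which is natural. -/
theorem zeroDifferentialHomologyIso_naturality {X X' : κ → A} (h : ∀ i, X i ⟶ X' i) (i : κ) :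
    homologyMap (zeroDifferentialMap c h) i ≫ (zeroDifferentialHomologyIso c X' i).hom =
      (zeroDifferentialHomologyIso c X i).hom ≫ (zeroDifferentialMap c h).f i := by
  have h₁ (X : κ → A) : (zeroDifferential c X).homologyπ i ≫
      (zeroDifferentialHomologyIso c X i).hom = (zeroDifferential c X).iCycles i := by
    rw [zeroDifferentialHomologyIso, Iso.trans_hom, Iso.symm_hom, iCyclesIso_hom,
      isoHomologyπ_hom_inv_id_assoc]
  rw [← cancel_epi ((zeroDifferential c X).homologyπ i), homologyπ_naturality_assoc, h₁,
    cyclesMap_i, reassoc_of% (h₁ X)]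

end HomologicalComplex

namespace E2HomologicalSpectralSequenceNat

open scoped ZeroObject

variable {A : Type w} [Category.{v} A] [Abelian A]

/-- The bigraded object with the objects `H p` in the row `q = 0` and zero in the other rows. -/
noncomputable def bottomRowX (H : ℕ → A) : ℕ × ℕ → A
  | (p, 0) => H p
  | (_, _ + 1) => 0

theorem isZero_bottomRowX (H : ℕ → A) (p q : ℕ) : IsZero (bottomRowX H (p, q + 1)) :=
  isZero_zero A

/-- The map of bigraded objects induced by maps of the objects of the row `q = 0`. -/
noncomputable def bottomRowXMap {H H' : ℕ → A} (h : ∀ n, H n ⟶ H' n) :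
    ∀ pq, bottomRowX H pq ⟶ bottomRowX H' pq
  | (p, 0) => h p
  | (_, _ + 1) => 0

variable (A) in
/-- The spectral sequence with `E^r_{p,0} = H p` and `E^r_{p,q} = 0` for `q > 0`, as a functor of
the graded object `H`. -/
noncomputable def bottomRow : (ℕ → A) ⥤ E2HomologicalSpectralSequenceNat A where
  obj H :=
    { page _ _ := HomologicalComplex.zeroDifferential _ (bottomRowX H)
      iso _ _ pq _ _ := HomologicalComplex.zeroDifferentialHomologyIso _ (bottomRowX H) pq }
  map h :=
    { hom _ _ := HomologicalComplex.zeroDifferentialMap _ (bottomRowXMap h)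
      comm _ _ pq _ _ :=
        HomologicalComplex.zeroDifferentialHomologyIso_naturality _ (bottomRowXMap h) pq }
  map_id H := by
    ext r hr pq
    match pq with
    | (p, 0) => rfl
    | (p, q + 1) => exact (isZero_bottomRowX H p q).eq_of_src _ _
  map_comp {H _ _} h h' := by
    ext r hr pq
    match pq with
    | (p, 0) => rfl
    | (p, q + 1) => exact (isZero_bottomRowX H p q).eq_of_src _ _

theorem isZero_bottomRow_limitTerm (H : ℕ → A) (p q : ℕ) :
    IsZero (((bottomRow A).obj H).limitTerm p (q + 1)) :=
  isZero_zero A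

theorem isZero_bottomRow_secondPage (H : ℕ → A) (p q : ℕ) :
    IsZero (((bottomRow A).obj H).secondPage p (q + 1)) :=
  isZero_zero A

/-- The limit term `E^∞_{p,0}` of a spectral sequence concentrated in the bottom row. -/
noncomputable def bottomRowLimitTermIso (H : ℕ → A) (p : ℕ) :
    H p ≅ ((bottomRow A).obj H).limitTerm p 0 :=
  Iso.refl (H p)

/-- The filtration on the abutment of a spectral sequence concentrated in the bottom row: it jumps
only in filtration degree `n`. -/
noncomputable def bottomRowFil (H : ℕ → A) (n k : ℕ) : Subobject (H n) :=
  -- The index `k` stands for `F_{k-1}`, so `k ≤ n` covers exactly the steps below `F_n`.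
  if k ≤ n then ⊥ else ⊤

theorem bottomRowFil_of_le (H : ℕ → A) {n k : ℕ} (h : k ≤ n) : bottomRowFil H n k = ⊥ :=
  if_pos h

theorem bottomRowFil_of_lt (H : ℕ → A) {n k : ℕ} (h : n < k) : bottomRowFil H n k = ⊤ :=
  if_neg h.not_ge

theorem isZero_of_eq_bot {Z : A} {P : Subobject Z} (h : P = ⊥) : IsZero (P : A) := by
  subst h
  exact IsZero.of_iso (isZero_zero A) Subobject.botCoeIsoZero

theorem isIso_arrow_of_eq_top {A : Type w} [Category.{v} A] {Z : A} {P : Subobject Z}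
    (h : P = ⊤) : IsIso P.arrow := by
  subst h
  infer_instance

/-- The projection of the filtration step `F_p` onto `E^∞_{p,q}`. -/
noncomputable def bottomRowProj (H : ℕ → A) (p : ℕ) : ∀ q : ℕ,
    (bottomRowFil H (p + q) (p + 1) : A) ⟶ ((bottomRow A).obj H).limitTerm p q
  | 0 => (bottomRowFil H p (p + 1)).arrow ≫ (bottomRowLimitTermIso H p).hom
  | _ + 1 => 0

theorem isIso_bottomRowProj (H : ℕ → A) (p : ℕ) : ∀ q : ℕ, IsIso (bottomRowProj H p q)
  | 0 => by
    have : IsIso (bottomRowFil H p (p + 1)).arrow :=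
      isIso_arrow_of_eq_top (bottomRowFil_of_lt H p.lt_succ_self)
    exact inferInstanceAs
      (IsIso ((bottomRowFil H p (p + 1)).arrow ≫ (bottomRowLimitTermIso H p).hom))
  | q + 1 =>
    (isZero_of_eq_bot (bottomRowFil_of_le H (by lia))).isIso (isZero_bottomRow_limitTerm H p q) _

/-- A spectral sequence concentrated in the bottom row converges to that row. -/
noncomputable def bottomRowConvergence (H : ℕ → A) : Convergence ((bottomRow A).obj H) H where
  fil := bottomRowFil H
  mono n i j hij := by
    by_cases hj : j ≤ n
    · rw [bottomRowFil_of_le H (hij.trans hj)]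
      exact bot_le
    · rw [bottomRowFil_of_lt H (not_le.1 hj)]
      exact le_top
  fil_zero n := bottomRowFil_of_le H n.zero_le
  fil_top n := bottomRowFil_of_lt H n.lt_succ_self
  proj := bottomRowProj H
  ofLE_proj p q := (isZero_of_eq_bot (bottomRowFil_of_le H (Nat.le_add_right p q))).eq_of_src _ _
  shortExact p q := by
    have hz : IsZero (bottomRowFil H (p + q) p : A) :=
      isZero_of_eq_bot (bottomRowFil_of_le H (Nat.le_add_right p q))
    have := isIso_bottomRowProj H p q
    exact
      -- As `F_{p-1} = 0` for every `q`, short exactness means that the projection is an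
      -- isomorphism.
      { exact := (ShortComplex.exact_iff_mono _ (hz.eq_of_src _ _)).2
          (inferInstanceAs (Mono (bottomRowProj H p q)))
        mono_f := ⟨fun _ _ _ => hz.eq_of_tgt _ _⟩
        epi_g := inferInstanceAs (Epi (bottomRowProj H p q)) }

theorem bottomRowConvergence_compatible {H H' : ℕ → A} (h : H ⟶ H') :
    (bottomRowConvergence H).Compatible (bottomRowConvergence H') ((bottomRow A).map h) h := by
  rintro p (_ | q)
  · have : IsIso (bottomRowFil H' p (p + 1)).arrow :=
      isIso_arrow_of_eq_top (bottomRowFil_of_lt H' p.lt_succ_self)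
    obtain ⟨a, e⟩ : ∃ a, a ≫ (bottomRowFil H' p (p + 1)).arrow =
        (bottomRowFil H p (p + 1)).arrow ≫ h p :=
      ⟨(bottomRowFil H p (p + 1)).arrow ≫ h p ≫ inv (bottomRowFil H' p (p + 1)).arrow, by simp⟩
    refine ⟨a, e, ?_⟩
    refine (Category.assoc _ _ _).symm.trans ((congrArg (· ≫ _) e).trans ?_)
    exact (Category.assoc _ _ _).trans ((congrArg ((bottomRowFil H p (p + 1)).arrow ≫ ·)
      ((Category.comp_id (h p)).trans (Category.id_comp (h p)).symm)).trans
      (Category.assoc _ _ _).symm)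
  · exact ⟨0, (isZero_of_eq_bot (bottomRowFil_of_le H (by lia))).eq_of_src _ _,
      (isZero_bottomRow_limitTerm H' p q).eq_of_tgt _ _⟩

end E2HomologicalSpectralSequenceNat

/-! ### The comparison of satellites and the spectral sequence -/

namespace GabrielZisman

section Comparison

variable {A : Type w} [Category.{v} A] [Abelian A] [HasColimitsOfSize.{u, u} A]
  [AB4OfSize.{u} A] {X Y X' Y' : SSet.{u}} {f : X ⟶ Y} {f' : X' ⟶ Y'}
  (S : LeftSatellites (lan A f)) (S' : LeftSatellites (lan A f')) (g : X ⟶ X') (h : Y ⟶ Y')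
  (w : g ≫ f' = f ≫ h)

/-- The comparison of satellites in degree zero. -/
noncomputable def comparisonZero : res A g ⋙ S.L 0 ⟶ S'.L 0 ⋙ res A h :=
  (Functor.whiskerLeft (res A g) S.iso₀.hom ≫ lanBaseChange A f f' g h w) ≫
    Functor.whiskerRight S'.iso₀.inv (res A h)

/-- The comparison of satellites; both sides vanish in positive degrees. -/
noncomputable def satelliteComparison : SatelliteComparison S S' g h w where
  app n := match n with
    | 0 => comparisonZero S S' g h w
    | n + 1 =>
      { app := fun Z => 0
        naturality := fun Z _ _ =>
          (S.isZero_of_preservesMonomorphisms n ((res A g).obj Z)).eq_of_src _ _ }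
  comm n Z hZ := (S.isZero_of_preservesMonomorphisms n ((res A g).obj Z.X₃)).eq_of_src _ _
  app_zero := by
    change comparisonZero S S' g h w ≫ (Functor.isoWhiskerRight S'.iso₀ (res A h)).hom = _
    exact (Iso.eq_comp_inv (Functor.isoWhiskerRight S'.iso₀ (res A h))).1 rfl

/-- Degree zero is prescribed up to the isomorphism `S'.iso₀`, and in positive degrees the source
vanishes. -/
theorem satelliteComparison_unique (κ κ' : SatelliteComparison S S' g h w) : κ = κ' := by
  obtain ⟨⟨a, ha⟩, h₀⟩ := κ
  obtain ⟨⟨a', ha'⟩, h₀'⟩ := κ'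
  obtain rfl : a = a' := by
    funext n
    match n with
    | 0 => exact (cancel_mono (Functor.whiskerRight S'.iso₀.hom (res A h))).1 (h₀.trans h₀'.symm)
    | n + 1 =>
      ext1
      funext Z
      exact (S.isZero_of_preservesMonomorphisms n ((res A g).obj Z)).eq_of_src _ _
  rfl

end Comparison

/-! ### Naturality of the edge isomorphism -/

section Naturality

/-- The type of `τ` depends on `φ`. Correcting by a morphism whose operator is the identity avoids a
heterogeneous equality. -/
theorem NatSystem.hom_ext_of_eq {A : Type w} [Category.{v} A] {S S' : NatSystem.{w, v, u} A}
    (a b : S ⟶ S') (h : a.φ = b.φ)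
    (hτ : ∀ x : OpSimplices S.X, a.τ.app x ≫ S'.T.map (CategoryOfElements.homMk
      ((opSimplicesMap a.φ).obj x) ((opSimplicesMap b.φ).obj x) (𝟙 x.1)
      ((ConcreteCategory.congr_hom (S'.X.map_id x.1) _).trans
        (ConcreteCategory.congr_hom (NatTrans.congr_app h x.1) x.2))) = b.τ.app x) : a = b := by
  obtain ⟨φ, τ⟩ := a
  obtain ⟨φ', τ'⟩ := b
  change φ = φ' at h
  subst h
  refine NatSystem.Hom.ext rfl (heq_of_eq ?_)
  ext x
  refine Eq.trans ?_ (hτ x)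
  exact ((congrArg (τ.app x ≫ ·) (S'.T.map_id _)).trans (Category.comp_id _)).symm

variable {A : Type w} [Category.{v} A] [Abelian A] [HasColimitsOfSize.{u, u} A]

/-- The unit formula for mates, through which alone base change enters the proof of naturality. -/
theorem lanUnit_lanBaseChange {A : Type w} [Category.{v} A] [HasColimitsOfSize.{u, u} A]
    {X Y X' Y' : SSet.{u}} (f : X ⟶ Y) (f' : X' ⟶ Y') (g : X ⟶ X') (h : Y ⟶ Y') (w : g ≫ f' = f ≫ h) (T : OpSimplices X' ⥤ A) :
    (opSimplicesMap f).lanUnit.app ((res A g).obj T) ≫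
        (res A f).map ((lanBaseChange A f f' g h w).app T) =
      (res A g).map ((opSimplicesMap f').lanUnit.app T) ≫
        (resSquareIso A f f' g h w).hom.app ((lan A f').obj T) := by
  have e := (unit_mateEquiv_symm ((opSimplicesMap f').lanAdjunction A)
    ((opSimplicesMap f).lanAdjunction A)
    (TwoSquare.mk _ _ _ _ (resSquareIso A f f' g h w).hom) T).symm
  rw [Functor.lanAdjunction_unit, Functor.lanAdjunction_unit] at e
  exact e

section

variable {X Y X' Y' : SSet.{u}} {f : X ⟶ Y} {f' : X' ⟶ Y'}

/-- The transformation that exhibits the degree-zero satellite as a left Kan extension. -/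
noncomputable def satelliteUnit (S : LeftSatellites (lan A f)) (T : OpSimplices X ⥤ A) :
    T ⟶ (res A f).obj ((S.L 0).obj T) :=
  (opSimplicesMap f).lanUnit.app T ≫ (res A f).map (S.iso₀.inv.app T)

theorem isLeftKanExtension_satelliteUnit (S : LeftSatellites (lan A f))
    (T : OpSimplices X ⥤ A) : ((S.L 0).obj T).IsLeftKanExtension (satelliteUnit S T) :=
  (Functor.isLeftKanExtension_iff_of_iso (S.iso₀.symm.app T)
    ((opSimplicesMap f).lanUnit.app T) (satelliteUnit S T) rfl).1 inferInstance

theorem satelliteUnit_comp_comparison (S : LeftSatellites (lan A f))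
    (S' : LeftSatellites (lan A f')) (g : X ⟶ X') (h : Y ⟶ Y') (w : g ≫ f' = f ≫ h)
    (k : res A g ⋙ S.L 0 ⟶ S'.L 0 ⋙ res A h)
    (hk : k ≫ Functor.whiskerRight S'.iso₀.hom (res A h) =
      Functor.whiskerLeft (res A g) S.iso₀.hom ≫ lanBaseChange A f f' g h w)
    {T : OpSimplices X ⥤ A} {T' : OpSimplices X' ⥤ A} (τ : T ⟶ (res A g).obj T') :
    τ ≫ (res A g).map (satelliteUnit S' T') ≫
        (resSquareIso A f f' g h w).hom.app ((S'.L 0).obj T') =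
      satelliteUnit S T ≫ (res A f).map ((S.L 0).map τ ≫ k.app T') := by
  have h₀ : k.app T' ≫ (res A h).map (S'.iso₀.hom.app T') =
      S.iso₀.hom.app ((res A g).obj T') ≫ (lanBaseChange A f f' g h w).app T' :=
    NatTrans.congr_app hk T'
  have h₁ : (opSimplicesMap f).lanUnit.app T ≫ (res A f).map ((lan A f).map τ) =
      τ ≫ (opSimplicesMap f).lanUnit.app ((res A g).obj T') :=
    ((opSimplicesMap f).lanUnit.naturality τ).symm
  have h₂ := (resSquareIso A f f' g h w).hom.naturality (S'.iso₀.inv.app T')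
  have h₃ : S.iso₀.inv.app T ≫ (S.L 0).map τ ≫ k.app T' = (lan A f).map τ ≫
      (lanBaseChange A f f' g h w).app T' ≫ (res A h).map (S'.iso₀.inv.app T') := by
    have e : S.iso₀.inv.app T ≫ (S.L 0).map τ =
        (lan A f).map τ ≫ S.iso₀.inv.app ((res A g).obj T') :=
      (S.iso₀.inv.naturality τ).symm
    -- Inserting `S.iso₀.inv ≫ S.iso₀.hom` before the base change map lets `h₀` trade it for `k`;
    -- then the `S'.iso₀` pair cancels.
    rw [reassoc_of% e, ← Iso.inv_hom_id_app_assoc S.iso₀ ((res A g).obj T')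
      ((lanBaseChange A f f' g h w).app T' ≫ _), ← reassoc_of% h₀, ← (res A h).map_comp,
      Iso.hom_inv_id_app, (res A h).map_id]
    exact congrArg (fun z => (lan A f).map τ ≫ S.iso₀.inv.app ((res A g).obj T') ≫ z)
      (Category.comp_id _).symm
  rw [satelliteUnit, satelliteUnit, Category.assoc, ← (res A f).map_comp, h₃,
    (res A f).map_comp, (res A f).map_comp, reassoc_of% h₁,
    reassoc_of% (lanUnit_lanBaseChange f f' g h w T'), (res A g).map_comp, Category.assoc]
  exact congrArg (fun z => τ ≫ (res A g).map ((opSimplicesMap f').lanUnit.app T') ≫ z) h₂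

end

variable (S : ∀ {X Y : SSet.{u}} (f : X ⟶ Y), LeftSatellites (lan A f))

/-- The morphism of natural systems `(X, T) ⟶ (Y, L_0 Lan_f T)`. -/
noncomputable def toSatelliteSystem (c : MapWithCoeff.{w, v, u} A) :
    c.left ⟶ satelliteSystem S 0 c :=
  NatSystem.Hom.mk c.f (satelliteUnit (S c.f) c.left.T)

theorem isIso_homology_map_toSatelliteSystem (c : MapWithCoeff.{w, v, u} A) (p : ℕ) :
    IsIso ((homology p).map (toSatelliteSystem S c)) :=
  have : (satelliteSystem S 0 c).T.IsLeftKanExtension (toSatelliteSystem S c).τ :=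
    isLeftKanExtension_satelliteUnit (S c.f) c.left.T
  isIso_homology_map (toSatelliteSystem S c) p

/-- The isomorphism `H_p(X, T) ≅ H_p(Y, L_0 Lan_f T)`. -/
noncomputable def homologyIsoSatelliteSystem (c : MapWithCoeff.{w, v, u} A) (p : ℕ) :
    (homology p).obj c.left ≅ (homology p).obj (satelliteSystem S 0 c) :=
  have := isIso_homology_map_toSatelliteSystem S c p
  asIso ((homology p).map (toSatelliteSystem S c))

/-- The simplicial parts `f' ∘ g` and `h ∘ f` agree only through `m.w`; the correction that
`NatSystem.hom_ext_of_eq` demands is the component of `resSquareIso`. -/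
theorem toSatelliteSystem_naturality {c c' : MapWithCoeff.{w, v, u} A} (m : c ⟶ c')
    (κ : SatelliteComparison (S c.f) (S c'.f) m.left.φ m.right m.w) :
    m.left ≫ toSatelliteSystem S c' = toSatelliteSystem S c ≫ satelliteSystemMap S 0 m κ :=
  NatSystem.hom_ext_of_eq _ _ m.w fun x =>
    (Category.assoc _ _ _).trans (NatTrans.congr_app (satelliteUnit_comp_comparison (S c.f)
      (S c'.f) m.left.φ m.right m.w (κ.app 0) κ.app_zero m.left.τ) x)

end Naturality

/-! ### The degenerate spectral sequence and its second page -/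

section Leray

variable (A : Type w) [Category.{v} A] [Abelian A] [HasColimitsOfSize.{u, u} A]

/-- The Leray spectral sequence.  As the left Kan extension along `(Δ/f)ᵒᵖ` is exact, it is
concentrated in the row `q = 0`, where its terms are those of the abutment. -/
noncomputable def lerayFunctor :
    MapWithCoeff.{w, v, u} A ⥤ E2HomologicalSpectralSequenceNat A :=
  Comma.fst _ _ ⋙ Functor.pi' (fun n => homology n) ⋙ E2HomologicalSpectralSequenceNat.bottomRow A

theorem homology_isZero {A : Type w} [Category.{v} A] [Abelian A] [HasColimitsOfSize.{u, u} A]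
    (S : NatSystem.{w, v, u} A) (hS : ∀ x, IsZero (S.T.obj x)) (p : ℕ) :
    IsZero ((homology p).obj S) := by
  have h : IsZero ((chainComplex.obj S).X p) := by
    rw [IsZero.iff_id_eq_zero]
    exact Sigma.hom_ext _ _ fun σ => (hS _).eq_of_src _ _
  exact (ShortComplex.exact_iff_isZero_homology _).1 (ShortComplex.exact_of_isZero_X₂ _ h)

variable {A} [AB4OfSize.{u} A]
  (S : ∀ {X Y : SSet.{u}} (f : X ⟶ Y), LeftSatellites (lan A f))

theorem isZero_homology_satelliteSystem (c : MapWithCoeff.{w, v, u} A) (p q : ℕ) :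
    IsZero ((homology p).obj (satelliteSystem S (q + 1) c)) :=
  homology_isZero _ (fun x => ((S c.f).isZero_of_preservesMonomorphisms q c.left.T).obj x) p

/-- The identification of the second page. -/
noncomputable def lerayIso (c : MapWithCoeff.{w, v, u} A) (p : ℕ) : ∀ q : ℕ,
    ((lerayFunctor A).obj c).secondPage p q ≅ (homology p).obj (satelliteSystem S q c)
  | 0 => homologyIsoSatelliteSystem S c p
  | q + 1 => (E2HomologicalSpectralSequenceNat.isZero_bottomRow_secondPage _ p q).iso
      (isZero_homology_satelliteSystem S c p q)

/-- The bottom row is homology applied to the square of `toSatelliteSystem_naturality`; in the other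
rows the target is zero. -/
theorem lerayIso_naturality {c c' : MapWithCoeff.{w, v, u} A} (m : c ⟶ c')
    (κ : SatelliteComparison (S c.f) (S c'.f) m.left.φ m.right m.w) (p : ℕ) : ∀ q : ℕ,
    E2HomologicalSpectralSequenceNat.secondPageMap ((lerayFunctor A).map m) p q ≫
        (lerayIso S c' p q).hom =
      (lerayIso S c p q).hom ≫ (homology p).map (satelliteSystemMap S q m κ)
  | 0 => ((homology p).map_comp _ _).symm.trans
      ((congrArg (homology p).map (toSatelliteSystem_naturality S m κ)).trans
        ((homology p).map_comp _ _))
  | q + 1 => (isZero_homology_satelliteSystem S c' p q).eq_of_tgt _ _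

end Leray

end GabrielZisman

/-- The Leray type homology spectral sequence.  First, the left satellites `L_q ((Δ/f)ᵒᵖ)_*` of the
left Kan extension along `(Δ/f)ᵒᵖ` exist for every map `f` of simplicial sets.  Moreover, for every
choice `S` of them, they depend naturally on `f` through unique comparison maps `κ`, and there is a
functor `E` from maps `f : X ⟶ Y` with coefficients `T : (Δ/X)ᵒᵖ ⥤ A` to first quadrant homology
spectral sequences with `E^2_{p,q} ≅ H_p^{GZ}(Y, L_q ((Δ/f)ᵒᵖ)_* T) ⇒ H_{p+q}^{GZ}(X, T)`, naturally
in `f` and `T`. -/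
theorem mainTheorem2 (A : Type w) [Category.{v} A] [Abelian A] [HasColimitsOfSize.{u, u} A]
    [AB4OfSize.{u} A] :
    (∀ {X Y : SSet.{u}} (f : X ⟶ Y), Nonempty (LeftSatellites (GabrielZisman.lan A f))) ∧
    ∀ (S : ∀ {X Y : SSet.{u}} (f : X ⟶ Y), LeftSatellites (GabrielZisman.lan A f)),
      ∃ κ : ∀ {X Y X' Y' : SSet.{u}} {f : X ⟶ Y} {f' : X' ⟶ Y'} (g : X ⟶ X') (h : Y ⟶ Y')
          (w : g ≫ f' = f ≫ h), GabrielZisman.SatelliteComparison (S f) (S f') g h w,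
        (∀ {X Y X' Y' : SSet.{u}} {f : X ⟶ Y} {f' : X' ⟶ Y'} (g : X ⟶ X') (h : Y ⟶ Y')
          (w : g ≫ f' = f ≫ h) (κ' : GabrielZisman.SatelliteComparison (S f) (S f') g h w),
          κ' = κ g h w) ∧
        ∃ (E : GabrielZisman.MapWithCoeff.{w, v, u} A ⥤ E2HomologicalSpectralSequenceNat A)
          (e : ∀ (c : GabrielZisman.MapWithCoeff.{w, v, u} A) (p q : ℕ),
            (E.obj c).secondPage p q ≅
              (GabrielZisman.homology p).obj (GabrielZisman.satelliteSystem S q c))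
          (conv : ∀ c : GabrielZisman.MapWithCoeff.{w, v, u} A,
            Convergence (E.obj c) (fun n => (GabrielZisman.homology n).obj c.left)),
          (∀ {c c' : GabrielZisman.MapWithCoeff.{w, v, u} A} (m : c ⟶ c') (p q : ℕ),
            E2HomologicalSpectralSequenceNat.secondPageMap (E.map m) p q ≫ (e c' p q).hom =
              (e c p q).hom ≫ (GabrielZisman.homology p).map
                (GabrielZisman.satelliteSystemMap S q m (κ m.left.φ m.right m.w))) ∧
          (∀ {c c' : GabrielZisman.MapWithCoeff.{w, v, u} A} (m : c ⟶ c'),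
            (conv c).Compatible (conv c') (E.map m)
              (fun n => (GabrielZisman.homology n).map m.left)) := by
  refine ⟨fun f => ⟨LeftSatellites.ofPreservesMonomorphisms (GabrielZisman.lan A f)⟩, fun S => ?_⟩
  refine ⟨fun g h w => GabrielZisman.satelliteComparison (S _) (S _) g h w,
    fun g h w κ' => GabrielZisman.satelliteComparison_unique _ _ g h w _ _,
    GabrielZisman.lerayFunctor A, GabrielZisman.lerayIso S,
    fun c => E2HomologicalSpectralSequenceNat.bottomRowConvergence _, fun m p q => ?_,
    fun m => E2HomologicalSpectralSequenceNat.bottomRowConvergence_compatible _⟩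
  exact GabrielZisman.lerayIso_naturality S m _ p q
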